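/- Let $n\ge 1$ and let $f:\mathbb{R}^n\to\mathbb{R}$ be differentiable with $L_f$-Lipschitz gradient ($L_f>0$) and $\mu$-strongly convex, $\mu>0$. Let $\theta\in(0,1/2)$, $\lambda\in(0,1)$, $\nu\in(0,1)$. Let $(x_k)_{k\ge 0}$ be a (deterministic) sequence in $\mathbb{R}^n$ whose steps $s_k:=x_{k+1}-x_k$ are all nonzero, and write $m_k:=\min\{\|s_{k-1}\|,\|s_k\|\}$ for $k\ge 1$. For every $k\ge 1$ let $$\Delta_k=\frac{\theta\mu}{\sqrt n\,L_f}\,m_k$$ and let $N_k$ be a natural number with $$N_k\ \ge\ \left[\frac{6n}{\mu^2(1-\lambda)^2\left(\frac12-\frac{\theta}{\sqrt n}\right)^2}\left(\frac{\|\nabla f(x_k)\|}{m_k}\right)^2+\frac{4n}{3\mu(1-\lambda)\left(\frac12-\frac{\theta}{\sqrt n}\right)}\,\frac{\|\nabla f(x_k)\|}{m_k}+\frac{2\theta\sqrt n}{3(1-\lambda)\left(\frac12-\frac{\theta}{\sqrt n}\right)^2}+\frac{3\theta^2 n}{2(1-\lambda)^2\left(\frac12-\frac{\theta}{\sqrt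 n}\right)^2}\right]\log\frac{n+1}{\nu}.$$ For every $k\ge 1$ let $u_{k,1},\dots,u_{k,N_k}$ be independent random vectors, each uniformly distributed on the unit sphere of $\mathbb{R}^n$, all defined on one probability space (no independence is required between different values of $k$), and let $$g^{\mathrm{SS}}_k=\frac{n}{N_k}\sum_{i=1}^{N_k}\frac{f(x_k+\Delta_k u_{k,i})-f(x_k)}{\Delta_k}\,u_{k,i},\qquad y^{\mathrm{SS}}_{k-1}=g^{\mathrm{SS}}_k-g^{\mathrm{SS}}_{k-1}\quad(k\ge 2).$$ Then for every $k\ge 2$, with probability at least $1-\nu$, $$(y^{\mathrm{SS}}_{k-1})^{\top}s_{k-1}>0.$$ -/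

import Mathlib

open MeasureTheory ProbabilityTheory
open scoped NNReal

/-- The uniform distribution on the Euclidean unit sphere of `ℝⁿ`: the surface measure on the
sphere, normalized to total mass one, seen as a measure on `ℝⁿ`. -/
noncomputable def uniformSphere (n : ℕ) : Measure (EuclideanSpace ℝ (Fin n)) :=
  ((volume : Measure (EuclideanSpace ℝ (Fin n))).toSphere Set.univ)⁻¹ •
    ((volume : Measure (EuclideanSpace ℝ (Fin n))).toSphere).map Subtype.val

/-- The spherical smoothing gradient estimator of `f` at `x` with radius `Δ` and
sampling directions `u₁, …, u_N`. -/
noncomputable def ssGrad {n N : ℕ} (f : EuclideanSpace ℝ (Fin n) → ℝ)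
    (x : EuclideanSpace ℝ (Fin n)) (Δ : ℝ) (u : Fin N → EuclideanSpace ℝ (Fin n)) :
    EuclideanSpace ℝ (Fin n) :=
  ((n : ℝ) / (N : ℝ)) • ∑ i, ((f (x + Δ • u i) - f x) / Δ) • u i

/-- The step `s_k = x_{k+1} - x_k`. -/
def iterStep {n : ℕ} (x : ℕ → EuclideanSpace ℝ (Fin n)) (k : ℕ) : EuclideanSpace ℝ (Fin n) :=
  x (k + 1) - x k

/-- The required sample size, where `r` stands for `‖∇f(x_k)‖ / min {‖s_{k-1}‖, ‖s_k‖}`. -/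
noncomputable def ssSampleSize (n : ℕ) (μ θ lam ν r : ℝ) : ℝ :=
  (6 * n / (μ ^ 2 * (1 - lam) ^ 2 * (1 / 2 - θ / √n) ^ 2) * r ^ 2
    + 4 * n / (3 * μ * (1 - lam) * (1 / 2 - θ / √n)) * r
    + 2 * θ * √n / (3 * (1 - lam) * (1 / 2 - θ / √n) ^ 2)
    + 3 * θ ^ 2 * n / (2 * (1 - lam) ^ 2 * (1 / 2 - θ / √n) ^ 2))
  * Real.log ((n + 1) / ν)

/-! ### First-order inequalities for strong convexity and Lipschitz gradients. -/

section FirstOrder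

variable {E : Type*} [NormedAddCommGroup E] [InnerProductSpace ℝ E] [CompleteSpace E]
  {f : E → ℝ}

/-! Let `w` be the unit vector along the step `s`. By strong convexity the exact gradient difference
has component at least `μ‖s‖` along `w` (`StrongConvexOn.mul_sq_le_inner_gradient_sub`). The
curvature is therefore positive once each of the two estimators has adverse error below `μm/2 ≤
μ‖s‖/2` along `w`, where `m` is the smaller step length at its iterate.

Only the fixed directions `±w` matter, so a scalar one-sided Bernstein bound suffices. Of the budget
`μm/2`, the smoothing bias uses at most `θμm/4` (`integral_mul_sub_div_mul_inner_le`), which leaves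
`(1/2 - θ/4)μm` for the random deviation. The prescribed sample size makes each failure probability
at most `ν/2` (`two_mul_add_mul_log_le_ssSampleSize`, `measureReal_inner_ssGrad_ge_le_half`). A
union bound over the two estimators concludes; it needs no independence between them. -/

lemma hasDerivAt_comp_add_smul (hf : Differentiable ℝ f) (x v : E) (t : ℝ) :
    HasDerivAt (fun t : ℝ => f (x + t • v)) (inner ℝ (gradient f (x + t • v)) v) t := by
  have h1 : HasDerivAt (fun t : ℝ => x + t • v) v t := by
    simpa using ((hasDerivAt_id t).smul_const v).const_add x
  rw [inner_gradient_left]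
  exact (hf _).hasFDerivAt.comp_hasDerivAt t h1

/-- Along the line through `x`, the function `f - μ/2 ‖·‖²` is convex, so its slope over `[0, 1]`
dominates its derivative at `0`. -/
lemma StrongConvexOn.add_inner_gradient_le {μ : ℝ} (hconv : StrongConvexOn Set.univ μ f)
    (hf : Differentiable ℝ f) (x v : E) :
    f x + inner ℝ (gradient f x) v + μ / 2 * ‖v‖ ^ 2 ≤ f (x + v) := by
  have h := strongConvexOn_iff_convex.1 hconv
  have h2 := h.comp_affineMap (AffineMap.lineMap (k := ℝ) x (x + v))
  have e : (fun x => f x - μ / 2 * ‖x‖ ^ 2) ∘ (AffineMap.lineMap (k := ℝ) x (x + v)) =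
      fun t : ℝ => f (x + t • v) - μ / 2 * (‖x‖ ^ 2 + 2 * t * inner ℝ x v + t ^ 2 * ‖v‖ ^ 2) := by
    ext t
    have : AffineMap.lineMap (k := ℝ) x (x + v) t = x + t • v := by
      simp [AffineMap.lineMap_apply, add_comm]
    simp only [Function.comp_apply, this, norm_add_sq_real, inner_smul_right, norm_smul, mul_pow,
      Real.norm_eq_abs, sq_abs]
    ring
  rw [e, Set.preimage_univ] at h2
  have hd : HasDerivAt (fun t : ℝ => f (x + t • v) -
      μ / 2 * (‖x‖ ^ 2 + 2 * t * inner ℝ x v + t ^ 2 * ‖v‖ ^ 2))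
      (inner ℝ (gradient f x) v - μ * inner ℝ x v) 0 := by
    have h1 := hasDerivAt_comp_add_smul hf x v 0
    rw [zero_smul, add_zero] at h1
    have h3 : HasDerivAt (fun t : ℝ =>
        μ / 2 * (‖x‖ ^ 2 + 2 * t * inner ℝ x v + t ^ 2 * ‖v‖ ^ 2)) (μ * inner ℝ x v) 0 := by
      have a := ((((hasDerivAt_id (0 : ℝ)).const_mul 2).mul_const (inner ℝ x v)).const_add
        (‖x‖ ^ 2)).add (((hasDerivAt_id (0 : ℝ)).pow 2).mul_const (‖v‖ ^ 2))
      refine (a.const_mul (μ / 2)).congr_deriv ?_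
      simp
      ring
    exact h1.sub h3
  have h4 := h2.le_slope_of_hasDerivAt (Set.mem_univ 0) (Set.mem_univ 1) one_pos hd
  simp only [slope_def_field, one_smul, zero_smul, add_zero, sub_zero, div_one] at h4
  linarith

lemma StrongConvexOn.mul_sq_le_inner_gradient_sub {μ : ℝ} (hconv : StrongConvexOn Set.univ μ f)
    (hf : Differentiable ℝ f) (x y : E) :
    μ * ‖y - x‖ ^ 2 ≤ inner ℝ (gradient f y - gradient f x) (y - x) := by
  have h1 := hconv.add_inner_gradient_le hf x (y - x)
  have h2 := hconv.add_inner_gradient_le hf y (x - y)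
  rw [add_sub_cancel] at h1 h2
  rw [norm_sub_rev x y, ← neg_sub y x, inner_neg_right] at h2
  rw [inner_sub_left]
  linarith

/-- Comparing derivatives along the segment avoids integrating the gradient. -/
lemma LipschitzWith.le_add_inner_gradient {K : ℝ≥0} (hLip : LipschitzWith K (gradient f))
    (hf : Differentiable ℝ f) (x v : E) :
    f (x + v) ≤ f x + inner ℝ (gradient f x) v + K / 2 * ‖v‖ ^ 2 := by
  have hB : ∀ t : ℝ, HasDerivAt (fun t : ℝ => f x + t * inner ℝ (gradient f x) v +
      K / 2 * ‖v‖ ^ 2 * t ^ 2) (inner ℝ (gradient f x) v + K * ‖v‖ ^ 2 * t) t := by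
    intro t
    have a := (((hasDerivAt_id t).mul_const (inner ℝ (gradient f x) v)).const_add (f x)).add
      (((hasDerivAt_id t).pow 2).const_mul (K / 2 * ‖v‖ ^ 2))
    refine a.congr_deriv ?_
    simp
    ring
  have h := image_le_of_deriv_right_le_deriv_boundary (a := (0 : ℝ)) (b := 1)
    (f := fun t : ℝ => f (x + t • v))
    (fun t _ => (hasDerivAt_comp_add_smul hf x v t).continuousAt.continuousWithinAt)
    (fun t _ => (hasDerivAt_comp_add_smul hf x v t).hasDerivWithinAt) (by simp)
    (fun t _ => (hB t).continuousAt.continuousWithinAt)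
    (fun t _ => (hB t).hasDerivWithinAt) (by
      intro t ht
      have h1 : inner ℝ (gradient f (x + t • v) - gradient f x) v ≤ K * ‖v‖ ^ 2 * t := by
        refine (real_inner_le_norm _ _).trans ?_
        have h2 := hLip.dist_le_mul (x + t • v) x
        rw [dist_eq_norm, dist_eq_norm, add_sub_cancel_left, norm_smul, Real.norm_eq_abs,
          abs_of_nonneg ht.1] at h2
        calc _ ≤ (K * (t * ‖v‖)) * ‖v‖ := by gcongr
          _ = _ := by ring
      rw [inner_sub_left] at h1
      linarith) (Set.right_mem_Icc.2 zero_le_one)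
  simpa using h

end FirstOrder

/-! ### Bernstein's inequality from bounds on the first two moments. -/

section Bernstein

/-- Since `(k+2)! ≥ 2·3^k`, the exponential series from the quadratic term on is dominated by a
geometric series of ratio `h/3`. -/
lemma Real.exp_le_one_add_add_sq_div {y h : ℝ} (hy : |y| ≤ h) (h3 : h < 3) :
    Real.exp y ≤ 1 + y + y ^ 2 / (2 * (1 - h / 3)) := by
  have h0 : 0 ≤ h := (abs_nonneg y).trans hy
  have hs := NormedSpace.expSeries_div_hasSum_exp (𝔸 := ℝ) y
  rw [← Real.exp_eq_exp_ℝ] at hs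
  have hs2 := (hasSum_nat_add_iff' 2).2 hs
  have hg := (hasSum_geometric_of_lt_one (r := h / 3) (by positivity) (by linarith)).mul_left
    (y ^ 2 / 2)
  have hle := hasSum_le (fun k => ?_) hs2 hg
  · simp only [Finset.sum_range_succ, Finset.sum_range_zero] at hle
    have : y ^ 2 / (2 * (1 - h / 3)) = y ^ 2 / 2 * (1 - h / 3)⁻¹ := by
      rw [div_mul_eq_div_div]; rfl
    rw [this]
    norm_num at hle
    linarith
  · have hfac : (2 * 3 ^ k : ℝ) ≤ ((k + 2).factorial : ℝ) := by
      have := Nat.factorial_mul_pow_le_factorial (m := 2) (n := k)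
      rw [add_comm k 2]
      exact_mod_cast this
    calc y ^ (k + 2) / ((k + 2).factorial : ℝ) ≤ |y| ^ (k + 2) / ((k + 2).factorial : ℝ) := by
          rw [← abs_pow]; gcongr; exact le_abs_self _
      _ ≤ |y| ^ (k + 2) / (2 * 3 ^ k) := by gcongr
      _ = y ^ 2 / 2 * (|y| / 3) ^ k := by
          rw [pow_add, sq_abs, div_pow]; field_simp
      _ ≤ y ^ 2 / 2 * (h / 3) ^ k := by gcongr

variable {Ω : Type*} [MeasurableSpace Ω] {P : Measure Ω} [IsProbabilityMeasure P]

/-- Because `s ≥ 0`, an upper bound on the mean suffices; using the raw second moment makes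
centering unnecessary. -/
lemma mgf_le_of_abs_le {X : Ω → ℝ} (hX : AEMeasurable X P) {R m V s : ℝ}
    (hR : ∀ᵐ ω ∂P, |X ω| ≤ R) (hm : P[X] ≤ m) (hV : P[X ^ 2] ≤ V) (hs : 0 ≤ s) (hs3 : s * R < 3) :
    mgf X P s ≤ Real.exp (s * m + s ^ 2 * V / (2 * (1 - s * R / 3))) := by
  have hc : 0 < 1 - s * R / 3 := by linarith
  have hXi : Integrable X P := .of_bound hX.aestronglyMeasurable R hR
  have hX2i : Integrable (X ^ 2) P := by
    refine .of_bound (hX.pow_const 2).aestronglyMeasurable (R ^ 2) ?_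
    filter_upwards [hR] with ω hω
    simp only [Pi.pow_apply, norm_pow, Real.norm_eq_abs]
    gcongr
  have hi1 : Integrable (fun ω => 1 + s * X ω) P := (integrable_const _).add (hXi.const_mul s)
  have hi2 : Integrable (fun ω => s ^ 2 / (2 * (1 - s * R / 3)) * (X ^ 2) ω) P := hX2i.const_mul _
  calc mgf X P s ≤ ∫ ω, (1 + s * X ω) + s ^ 2 / (2 * (1 - s * R / 3)) * (X ^ 2) ω ∂P := by
        refine integral_mono_of_nonneg (.of_forall fun _ => (Real.exp_pos _).le) (hi1.add hi2) ?_
        filter_upwards [hR] with ω hω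
        have := Real.exp_le_one_add_add_sq_div (y := s * X ω) (h := s * R)
          (by rw [abs_mul, abs_of_nonneg hs]; gcongr) hs3
        simp only [Pi.pow_apply]
        rw [mul_pow, mul_div_right_comm] at this
        linarith
    _ = 1 + s * P[X] + s ^ 2 / (2 * (1 - s * R / 3)) * P[X ^ 2] := by
        rw [integral_add hi1 hi2, integral_add (integrable_const _) (hXi.const_mul s),
          integral_const_mul, integral_const_mul]
        simp
    _ ≤ 1 + s * m + s ^ 2 / (2 * (1 - s * R / 3)) * V := by gcongr
    _ ≤ _ := by
        refine le_trans (le_of_eq ?_) (Real.add_one_le_exp _)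
        ring

/-- **Bernstein's inequality** for independent bounded real random variables. -/
theorem measureReal_sum_ge_le_of_abs_le {ι : Type*} [Fintype ι] {X : ι → Ω → ℝ}
    (hindep : iIndepFun X P) (hX : ∀ i, AEMeasurable (X i) P) {R m V t : ℝ}
    (hR : ∀ i, ∀ᵐ ω ∂P, |X i ω| ≤ R) (hm : ∀ i, P[X i] ≤ m) (hV : ∀ i, P[X i ^ 2] ≤ V)
    (hR0 : 0 ≤ R) (hV0 : 0 < V) (ht : 0 ≤ t) :
    P.real {ω | Fintype.card ι * (m + t) ≤ ∑ i, X i ω} ≤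
      Real.exp (-(Fintype.card ι * t ^ 2 / (2 * (V + R * t / 3)))) := by
  set D := V + R * t / 3 with hD
  have hDpos : 0 < D := by positivity
  -- This Chernoff parameter gives `1 - s * R / 3 = V / D`, so the quadratic term becomes `s² D /
  -- 2`.
  set s := t / D with hs
  have hs0 : 0 ≤ s := by positivity
  have hc : 1 - s * R / 3 = V / D := by
    rw [hs]; field_simp; rw [hD]; ring
  have hs3 : s * R < 3 := by
    have : 0 < V / D := by positivity
    linarith
  have hb : ∀ᵐ ω ∂P, ∀ i, |X i ω| ≤ R := ae_all_iff.2 hR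
  have hint : Integrable (fun ω => Real.exp (s * (∑ i, X i) ω)) P := by
    refine .of_bound (C := Real.exp (s * (Fintype.card ι * R))) ?_ ?_
    · exact (Real.measurable_exp.comp_aemeasurable
        ((Finset.aemeasurable_sum _ fun i _ => hX i).const_mul s)).aestronglyMeasurable
    · filter_upwards [hb] with ω hω
      rw [Real.norm_eq_abs, Real.abs_exp, Finset.sum_apply]
      gcongr
      calc ∑ i, X i ω ≤ ∑ _i : ι, R := Finset.sum_le_sum fun i _ => (le_abs_self _).trans (hω i)
        _ = _ := by simp
  have h := measure_ge_le_exp_mul_mgf (X := ∑ i, X i) (μ := P) (Fintype.card ι * (m + t)) hs0 hint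
  rw [hindep.mgf_sum₀ hX] at h
  simp only [Finset.sum_apply] at h
  refine h.trans ?_
  calc _ ≤ Real.exp (-s * (Fintype.card ι * (m + t))) *
        ∏ _i : ι, Real.exp (s * m + s ^ 2 * V / (2 * (1 - s * R / 3))) := by
        gcongr with i
        · exact fun i _ => mgf_nonneg
        · exact mgf_le_of_abs_le (hX i) (hR i) (hm i) (hV i) hs0 hs3
    _ = _ := by
        rw [Finset.prod_const, ← Real.exp_nat_mul, ← Real.exp_add, hc, Finset.card_univ]
        congr 1
        rw [hs]
        field_simp
        ring

end Bernstein

/-! ### Invariance and second moments of the uniform law on the sphere. -/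

section Sphere

open Set Metric
open scoped Pointwise

variable {n : ℕ}

local notation "𝔼" n => EuclideanSpace ℝ (Fin n)

lemma ae_norm_eq_one_uniformSphere : ∀ᵐ u ∂uniformSphere n, ‖u‖ = 1 := by
  refine Measure.ae_smul_measure ?_ _
  rw [ae_map_iff (by fun_prop) (measurableSet_eq_fun (by fun_prop) (by fun_prop))]
  exact .of_forall fun u => by simp

lemma isProbabilityMeasure_uniformSphere (hn : n ≠ 0) :
    IsProbabilityMeasure (uniformSphere n) := by
  have : Nonempty (Fin n) := ⟨⟨0, Nat.pos_of_ne_zero hn⟩⟩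
  refine ⟨?_⟩
  rw [uniformSphere, Measure.smul_apply, Measure.map_apply measurable_subtype_coe .univ,
    preimage_univ, smul_eq_mul, ENNReal.inv_mul_cancel]
  · exact Measure.measure_univ_ne_zero.2 (Measure.toSphere_ne_zero _)
  · exact measure_ne_top _ _

/-- Up to a constant factor, the surface measure of a set is the volume of the cone over it;
isometries commute with forming cones and preserve volume. -/
lemma map_uniformSphere (A : (𝔼 n) ≃ₗᵢ[ℝ] (𝔼 n)) :
    (uniformSphere n).map A = uniformSphere n := by
  rw [uniformSphere, Measure.map_smul]
  congr 1
  ext s hs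
  have hA : Measurable A := A.continuous.measurable
  rw [Measure.map_apply hA hs, Measure.map_apply measurable_subtype_coe (hA hs),
    Measure.map_apply measurable_subtype_coe hs,
    Measure.toSphere_apply' _ (measurable_subtype_coe (hA hs)),
    Measure.toSphere_apply' _ (measurable_subtype_coe hs)]
  congr 1
  rw [Subtype.image_preimage_coe, Subtype.image_preimage_coe]
  have hpre : Ioo (0 : ℝ) 1 • (sphere (0 : 𝔼 n) 1 ∩ A ⁻¹' s) =
      A ⁻¹' (Ioo (0 : ℝ) 1 • (sphere (0 : 𝔼 n) 1 ∩ s)) := by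
    ext y
    simp only [mem_smul, mem_preimage, mem_inter_iff, mem_sphere_zero_iff_norm]
    constructor
    · rintro ⟨r, hr, z, ⟨hz, hzs⟩, rfl⟩
      exact ⟨r, hr, A z, ⟨by simpa using hz, hzs⟩, by simp⟩
    · rintro ⟨r, hr, z, ⟨hz, hzs⟩, h⟩
      refine ⟨r, hr, A.symm z, ⟨by simpa using hz, by simpa using hzs⟩, ?_⟩
      rw [← map_smul, h, A.symm_apply_apply]
  rw [hpre]
  exact A.measurePreserving.measure_preimage_emb A.toHomeomorph.measurableEmbedding _

lemma integral_comp_uniformSphere (A : (𝔼 n) ≃ₗᵢ[ℝ] (𝔼 n)) (g : (𝔼 n) → ℝ) :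
    ∫ u, g (A u) ∂uniformSphere n = ∫ u, g u ∂uniformSphere n := by
  conv_rhs => rw [← map_uniformSphere A]
  exact (A.toHomeomorph.measurableEmbedding.integral_map g).symm

lemma integrable_uniformSphere (hn : n ≠ 0) {g : (𝔼 n) → ℝ} (hg : Continuous g) :
    Integrable g (uniformSphere n) := by
  have := isProbabilityMeasure_uniformSphere hn
  obtain ⟨C, hC⟩ := (isCompact_sphere (0 : 𝔼 n) 1).exists_bound_of_continuousOn hg.continuousOn
  refine .of_bound hg.aestronglyMeasurable C ?_
  filter_upwards [ae_norm_eq_one_uniformSphere] with u hu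
  exact hC u (by simpa using hu)

lemma integral_inner_uniformSphere (w : 𝔼 n) :
    ∫ u, inner ℝ u w ∂uniformSphere n = 0 := by
  have h := integral_comp_uniformSphere (LinearIsometryEquiv.neg ℝ) (fun u : 𝔼 n => inner ℝ u w)
  simp only [LinearIsometryEquiv.coe_neg, inner_neg_left, integral_neg] at h
  linarith

/-- A reflection exchanges `w` with any basis vector, so all `n` coordinates share this second
moment, and their squares sum to `1`. -/
lemma integral_inner_sq_uniformSphere_of_norm_eq_one (hn : n ≠ 0) {w : 𝔼 n} (hw : ‖w‖ = 1) :
    ∫ u, inner ℝ u w ^ 2 ∂uniformSphere n = 1 / n := by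
  have := isProbabilityMeasure_uniformSphere hn
  have key : ∀ i : Fin n, ∫ u, inner ℝ u w ^ 2 ∂uniformSphere n =
      ∫ u, inner ℝ u (EuclideanSpace.basisFun (Fin n) ℝ i) ^ 2 ∂uniformSphere n := by
    intro i
    set e := EuclideanSpace.basisFun (Fin n) ℝ i
    have he : ‖e‖ = ‖w‖ := by rw [hw]; exact OrthonormalBasis.norm_eq_one _ i
    have h := integral_comp_uniformSphere (Submodule.reflection (ℝ ∙ (e - w))ᗮ)
      (fun u : 𝔼 n => inner ℝ u w ^ 2)
    rw [← h]
    refine integral_congr_ae (.of_forall fun u => ?_)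
    have h1 := LinearIsometryEquiv.inner_map_map (Submodule.reflection (ℝ ∙ (e - w))ᗮ) u e
    rw [Submodule.reflection_sub he] at h1
    dsimp only
    rw [h1]
  have hsum : ∑ i : Fin n, ∫ u, inner ℝ u (EuclideanSpace.basisFun (Fin n) ℝ i) ^ 2
      ∂uniformSphere n = 1 := by
    rw [← integral_finsetSum _ fun i _ => integrable_uniformSphere hn (by fun_prop)]
    calc _ = ∫ _u, (1 : ℝ) ∂uniformSphere n := by
          refine integral_congr_ae ?_
          filter_upwards [ae_norm_eq_one_uniformSphere] with u hu
          rw [OrthonormalBasis.sum_sq_inner_left, hu, one_pow]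
      _ = 1 := by simp
  rw [← Finset.sum_congr rfl fun i _ => key i] at hsum
  simp only [Finset.sum_const, Finset.card_univ, Fintype.card_fin, nsmul_eq_mul] at hsum
  rw [eq_div_iff (by exact_mod_cast hn), mul_comm]
  exact hsum

lemma integral_inner_sq_uniformSphere (hn : n ≠ 0) (w : 𝔼 n) :
    ∫ u, inner ℝ u w ^ 2 ∂uniformSphere n = ‖w‖ ^ 2 / n := by
  rcases eq_or_ne w 0 with rfl | hw
  · simp
  have h := integral_inner_sq_uniformSphere_of_norm_eq_one hn (norm_smul_inv_norm (𝕜 := ℝ) hw)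
  have hw' : ‖w‖ ≠ 0 := norm_ne_zero_iff.2 hw
  simp only [inner_smul_right, mul_pow, integral_const_mul, RCLike.ofReal_real_eq_id, id] at h
  rw [← mul_one_div, ← h]
  field_simp

lemma integral_inner_mul_inner_uniformSphere (hn : n ≠ 0) (v w : 𝔼 n) :
    ∫ u, inner ℝ u v * inner ℝ u w ∂uniformSphere n = inner ℝ v w / n := by
  have h : ∀ u : 𝔼 n, inner ℝ u v * inner ℝ u w =
      1 / 4 * inner ℝ u (v + w) ^ 2 - 1 / 4 * inner ℝ u (v - w) ^ 2 := by
    intro u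
    rw [inner_add_right, inner_sub_right]
    ring
  simp only [h]
  rw [integral_sub ((integrable_uniformSphere hn (by fun_prop)).const_mul _)
    ((integrable_uniformSphere hn (by fun_prop)).const_mul _), integral_const_mul,
    integral_const_mul, integral_inner_sq_uniformSphere hn, integral_inner_sq_uniformSphere hn,
    norm_add_sq_real, norm_sub_sq_real]
  ring

end Sphere

/-- The left side is what Bernstein demands after scaling by `μm`. Expanding it gives four terms,
each dominated by one term of the sample size because `1 - lam ≤ 1` and `1/2 - θ/√n ≤ 1/2`, whereas
`1/2 - θ/4 ≥ 3/8`. -/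
lemma two_mul_add_mul_log_le_ssSampleSize {n : ℕ} (hn : 1 ≤ n) {μ θ lam ν r : ℝ} (hμ : 0 < μ)
    (hθ : θ ∈ Set.Ioo (0 : ℝ) (1 / 2)) (hlam : lam ∈ Set.Ioo (0 : ℝ) 1)
    (hν : ν ∈ Set.Ioo (0 : ℝ) 1) (hr : 0 ≤ r) :
    2 * (n * (r / μ + θ / (2 * √n)) ^ 2 + n * (r / μ + θ / (2 * √n)) * (1 / 2 - θ / 4) / 3)
      * Real.log ((n + 1) / ν) ≤ ssSampleSize n μ θ lam ν r * (1 / 2 - θ / 4) ^ 2 := by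
  obtain ⟨hθ0, hθ1⟩ := hθ
  obtain ⟨hl0, hl1⟩ := hlam
  obtain ⟨hν0, hν1⟩ := hν
  have hn' : (1 : ℝ) ≤ n := by exact_mod_cast hn
  have hlog : 0 ≤ Real.log ((n + 1) / ν) :=
    Real.log_nonneg ((one_le_div hν0).2 (by linarith))
  obtain ⟨s, hs⟩ : ∃ s, s = √(n : ℝ) := ⟨_, rfl⟩
  have hs2 : s ^ 2 = n := by rw [hs]; exact Real.sq_sqrt (by positivity)
  have hs1 : 1 ≤ s := by rw [hs]; exact Real.one_le_sqrt.2 hn'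
  have hs0 : 0 < s := by linarith
  rw [ssSampleSize, mul_right_comm _ (Real.log _), ← hs]
  refine mul_le_mul_of_nonneg_right ?_ hlog
  have hts0 : 0 < θ / s := by positivity
  have hts : θ / s ≤ θ := div_le_self hθ0.le hs1
  obtain ⟨c, hc⟩ : ∃ c, c = 1 / 2 - θ / s := ⟨_, rfl⟩
  obtain ⟨a, ha⟩ : ∃ a, a = 1 - lam := ⟨_, rfl⟩
  obtain ⟨τ, hτ⟩ : ∃ τ, τ = 1 / 2 - θ / 4 := ⟨_, rfl⟩
  obtain ⟨g, hg⟩ : ∃ g, g = r / μ := ⟨_, rfl⟩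
  have hr' : r = g * μ := by rw [hg]; field_simp
  have hg0 : 0 ≤ g := by rw [hg]; positivity
  rw [← hc, ← ha, ← hτ, ← hg, hr', ← hs2]
  have hc0 : 0 < c := by linarith
  have hc1 : c ≤ 1 / 2 := by linarith
  have ha0 : 0 < a := by linarith
  have ha1 : a ≤ 1 := by linarith
  have hτ1 : 3 / 8 ≤ τ := by linarith
  have hτ0 : 0 < τ := by linarith
  have hac : a * c ≤ c := mul_le_of_le_one_left hc0.le ha1
  have hac0 : 0 < a * c := by positivity
  have hac2 : (a * c) ^ 2 ≤ c ^ 2 := by gcongr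
  have hc2 : c ^ 2 ≤ (1 / 2) ^ 2 := by gcongr
  have hτ2 : (3 / 8) ^ 2 ≤ τ ^ 2 := by gcongr
  have h1 : (a * c) ^ 2 ≤ 2 * τ ^ 2 := by linarith
  have h2 : (a * c) ^ 2 ≤ s ^ 2 * τ ^ 2 := by
    -- For `n = 1` the numerical bounds on `c` and `τ` are too weak; there `c = 1/2 - θ ≤ τ` is used
    -- directly.
    rcases hn.eq_or_lt with h | h
    · have : s = 1 := by rw [hs, ← h]; simp
      subst this
      have : c ≤ τ := by rw [hc, hτ]; linarith
      rw [one_pow, one_mul]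
      exact hac2.trans (by gcongr)
    · have : (2 : ℝ) ≤ s ^ 2 := by rw [hs2]; exact_mod_cast h
      exact h1.trans (by gcongr)
  have h3 : a * c ≤ 2 * τ := by linarith
  have h4 : a * c ^ 2 ≤ 2 * τ := by
    have := mul_le_of_le_one_left (sq_nonneg c) ha1
    linarith
  have e1 : 3 * s ^ 2 * g ^ 2 ≤ 6 * s ^ 2 / (μ ^ 2 * a ^ 2 * c ^ 2) * (g * μ) ^ 2 * τ ^ 2 := by
    have : 6 * s ^ 2 / (μ ^ 2 * a ^ 2 * c ^ 2) * (g * μ) ^ 2 * τ ^ 2 =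
        3 * s ^ 2 * g ^ 2 * (2 * τ ^ 2 / (a * c) ^ 2) := by field_simp; ring
    rw [this]
    exact le_mul_of_one_le_right (by positivity) ((one_le_div (by positivity)).2 h1)
  have e2 : 2 / 3 * s ^ 2 * g * τ ≤ 4 * s ^ 2 / (3 * μ * a * c) * (g * μ) * τ ^ 2 := by
    have : 4 * s ^ 2 / (3 * μ * a * c) * (g * μ) * τ ^ 2 =
        2 / 3 * s ^ 2 * g * τ * (2 * τ / (a * c)) := by field_simp; ring
    rw [this]
    exact le_mul_of_one_le_right (by positivity) ((one_le_div (by positivity)).2 h3)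
  have e3 : θ * s / 3 * τ ≤ 2 * θ * s / (3 * a * c ^ 2) * τ ^ 2 := by
    have : 2 * θ * s / (3 * a * c ^ 2) * τ ^ 2 =
        θ * s / 3 * τ * (2 * τ / (a * c ^ 2)) := by field_simp
    rw [this]
    exact le_mul_of_one_le_right (by positivity) ((one_le_div (by positivity)).2 h4)
  have e4 : 3 / 2 * θ ^ 2 ≤ 3 * θ ^ 2 * s ^ 2 / (2 * a ^ 2 * c ^ 2) * τ ^ 2 := by
    have : 3 * θ ^ 2 * s ^ 2 / (2 * a ^ 2 * c ^ 2) * τ ^ 2 =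
        3 / 2 * θ ^ 2 * (s ^ 2 * τ ^ 2 / (a * c) ^ 2) := by field_simp
    rw [this]
    exact le_mul_of_one_le_right (by positivity) ((one_le_div (by positivity)).2 h2)
  have e5 : 2 * (s ^ 2 * (g + θ / (2 * s)) ^ 2 + s ^ 2 * (g + θ / (2 * s)) * τ / 3) =
      2 * (s * g + θ / 2) ^ 2 + (2 / 3 * s ^ 2 * g * τ + θ * s / 3 * τ) := by
    field_simp
  rw [e5]
  have e6 : 2 * (s * g + θ / 2) ^ 2 ≤ 3 * s ^ 2 * g ^ 2 + 3 / 2 * θ ^ 2 := by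
    have : 3 * s ^ 2 * g ^ 2 + 3 / 2 * θ ^ 2 - 2 * (s * g + θ / 2) ^ 2 = (s * g - θ) ^ 2 := by ring
    rw [← sub_nonneg, this]
    exact sq_nonneg _
  linarith

/-! ### Bias, second moment and tails of the estimator in a fixed direction. -/

section Estimator

variable {n : ℕ} {f : EuclideanSpace ℝ (Fin n) → ℝ} {L : ℝ≥0}
  {x w : EuclideanSpace ℝ (Fin n)} {D : ℝ}

lemma sub_div_sub_inner_gradient_mem_Icc (hf : Differentiable ℝ f)
    (hLip : LipschitzWith L (gradient f)) (hconv : StrongConvexOn Set.univ 0 f) (hD : 0 < D)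
    {u : EuclideanSpace ℝ (Fin n)} (hu : ‖u‖ = 1) :
    (f (x + D • u) - f x) / D - inner ℝ u (gradient f x) ∈ Set.Icc 0 (L * D / 2) := by
  have h1 := hconv.add_inner_gradient_le hf x (D • u)
  have h2 := hLip.le_add_inner_gradient hf x (D • u)
  rw [inner_smul_right, real_inner_comm] at h1 h2
  rw [norm_smul, hu, mul_one, Real.norm_eq_abs, sq_abs] at h2
  constructor
  · rw [sub_nonneg, le_div_iff₀ hD]
    linarith
  · rw [sub_le_iff_le_add, div_le_iff₀ hD]
    linarith

lemma abs_sub_div_le (hf : Differentiable ℝ f)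
    (hLip : LipschitzWith L (gradient f)) (hconv : StrongConvexOn Set.univ 0 f) (hD : 0 < D)
    {u : EuclideanSpace ℝ (Fin n)} (hu : ‖u‖ = 1) :
    |(f (x + D • u) - f x) / D| ≤ ‖gradient f x‖ + L * D / 2 := by
  have h := sub_div_sub_inner_gradient_mem_Icc (x := x) hf hLip hconv hD hu
  have h1 := abs_real_inner_le_norm u (gradient f x)
  rw [hu, one_mul, abs_le] at h1
  rw [abs_le]
  constructor <;> linarith [h.1, h.2, h1.1, h1.2, norm_nonneg (gradient f x)]

lemma continuous_sub_div_mul_inner (hf : Differentiable ℝ f) :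
    Continuous fun u : EuclideanSpace ℝ (Fin n) =>
      n * ((f (x + D • u) - f x) / D * inner ℝ u w) := by
  have := hf.continuous
  fun_prop

lemma abs_mul_sub_div_mul_inner_le (hf : Differentiable ℝ f)
    (hLip : LipschitzWith L (gradient f)) (hconv : StrongConvexOn Set.univ 0 f) (hD : 0 < D)
    (hw : ‖w‖ = 1) {u : EuclideanSpace ℝ (Fin n)} (hu : ‖u‖ = 1) :
    |n * ((f (x + D • u) - f x) / D * inner ℝ u w)| ≤ n * (‖gradient f x‖ + L * D / 2) := by
  have h1 := abs_real_inner_le_norm u w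
  rw [hu, hw, one_mul] at h1
  rw [abs_mul, abs_mul, Nat.abs_cast]
  gcongr
  exact (mul_le_of_le_one_right (abs_nonneg _) h1).trans (abs_sub_div_le hf hLip hconv hD hu)

/-- By convexity the Taylor remainder lies in `[0, LD/2]`. Subtracting its midpoint `LD/4` costs
nothing, as `inner ℝ u w` has mean zero, and halves the error. The factor `√n` comes from `√n|y| ≤
(n y² + 1)/2`, whose right side has mean `1`. -/
lemma integral_mul_sub_div_mul_inner_le (hn : n ≠ 0) (hf : Differentiable ℝ f)
    (hLip : LipschitzWith L (gradient f)) (hconv : StrongConvexOn Set.univ 0 f) (hD : 0 < D)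
    (hw : ‖w‖ = 1) :
    ∫ u, n * ((f (x + D • u) - f x) / D * inner ℝ u w) ∂uniformSphere n ≤
      inner ℝ (gradient f x) w + √n * L * D / 4 := by
  have := isProbabilityMeasure_uniformSphere hn
  have hs0 : 0 < √(n : ℝ) := Real.sqrt_pos.2 (by positivity)
  have hs2 : √(n : ℝ) * √n = n := Real.mul_self_sqrt (by positivity)
  have i1 := (integrable_uniformSphere hn (g := fun u => inner ℝ u (gradient f x) * inner ℝ u w)
    (by fun_prop)).const_mul (n : ℝ)
  have i2 := (integrable_uniformSphere hn (g := fun u => inner ℝ u w)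
    (by fun_prop)).const_mul (n * (L * D / 4))
  have i3 := (integrable_uniformSphere hn (g := fun u => inner ℝ u w ^ 2)
    (by fun_prop)).const_mul (n * (L * D / 4) * √n / 2)
  have i4 : Integrable (fun _ => √(n : ℝ) * (L * D / 4) / 2) (uniformSphere n) :=
    integrable_const _
  have i12 : Integrable (fun u => n * (inner ℝ u (gradient f x) * inner ℝ u w) +
      n * (L * D / 4) * inner ℝ u w) (uniformSphere n) := i1.add i2
  have i123 : Integrable (fun u => n * (inner ℝ u (gradient f x) * inner ℝ u w) +
      n * (L * D / 4) * inner ℝ u w + n * (L * D / 4) * √n / 2 * inner ℝ u w ^ 2)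
      (uniformSphere n) := i12.add i3
  calc _ ≤ ∫ u, (n * (inner ℝ u (gradient f x) * inner ℝ u w) +
          n * (L * D / 4) * inner ℝ u w + n * (L * D / 4) * √n / 2 * inner ℝ u w ^ 2) +
          √n * (L * D / 4) / 2 ∂uniformSphere n := by
        refine integral_mono_ae (integrable_uniformSphere hn (continuous_sub_div_mul_inner hf))
          (i123.add i4) ?_
        filter_upwards [ae_norm_eq_one_uniformSphere] with u hu
        have h := sub_div_sub_inner_gradient_mem_Icc (x := x) hf hLip hconv hD hu
        set q := (f (x + D • u) - f x) / D
        set p := inner ℝ u (gradient f x)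
        set y := inner ℝ u w
        set c := L * D / 4 with hc
        have hc0 : 0 ≤ c := by positivity
        have h1 : (q - p - c) * y ≤ c * |y| := by
          refine (le_abs_self _).trans ?_
          rw [abs_mul]
          gcongr
          rw [abs_le]
          constructor <;> linarith [h.1, h.2]
        have h2 : √n * |y| ≤ (n * y ^ 2 + 1) / 2 := by
          nlinarith [sq_nonneg (√n * |y| - 1), sq_abs y]
        have h3 : n * (q * y) = n * (p * y) + n * c * y + √n * (√n * ((q - p - c) * y)) := by
          rw [← mul_assoc (√(n : ℝ)), hs2]; ring
        have h4 : √n * (√n * ((q - p - c) * y)) ≤ √n * (√n * (c * |y|)) := by gcongr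
        have h5 : √n * c * (√n * |y|) ≤ √n * c * ((n * y ^ 2 + 1) / 2) := by gcongr
        linarith
    _ = _ := by
        rw [integral_add i123 i4, integral_add i12 i3, integral_add i1 i2,
          integral_const_mul, integral_const_mul, integral_const_mul,
          integral_inner_mul_inner_uniformSphere hn, integral_inner_uniformSphere,
          integral_inner_sq_uniformSphere hn, hw]
        simp only [integral_const, probReal_univ, one_smul]
        field_simp
        ring

/-- The mean `1/n` of `inner ℝ u w ^ 2` reduces the factor `n²` to `n`. -/
lemma integral_mul_sub_div_mul_inner_sq_le (hn : n ≠ 0) (hf : Differentiable ℝ f)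
    (hLip : LipschitzWith L (gradient f)) (hconv : StrongConvexOn Set.univ 0 f) (hD : 0 < D)
    (hw : ‖w‖ = 1) :
    ∫ u, (n * ((f (x + D • u) - f x) / D * inner ℝ u w)) ^ 2 ∂uniformSphere n ≤
      n * (‖gradient f x‖ + L * D / 2) ^ 2 := by
  calc _ ≤ ∫ u, n ^ 2 * (‖gradient f x‖ + L * D / 2) ^ 2 * inner ℝ u w ^ 2 ∂uniformSphere n := by
        refine integral_mono_ae (integrable_uniformSphere hn
          ((continuous_sub_div_mul_inner hf).pow 2)) (integrable_uniformSphere hn (by fun_prop)) ?_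
        filter_upwards [ae_norm_eq_one_uniformSphere] with u hu
        rw [mul_pow, mul_pow, ← mul_assoc]
        refine mul_le_mul_of_nonneg_right (mul_le_mul_of_nonneg_left ?_ (by positivity))
          (sq_nonneg _)
        exact sq_le_sq' (abs_le.1 (abs_sub_div_le hf hLip hconv hD hu)).1
          (abs_le.1 (abs_sub_div_le hf hLip hconv hD hu)).2
    _ = _ := by
        rw [integral_const_mul, integral_inner_sq_uniformSphere hn, hw]
        field_simp

lemma inner_ssGrad {N : ℕ} (u : Fin N → EuclideanSpace ℝ (Fin n)) :
    inner ℝ (ssGrad f x D u) w =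
      (∑ i, n * ((f (x + D • u i) - f x) / D * inner ℝ (u i) w)) / N := by
  rw [ssGrad, real_inner_smul_left, sum_inner, ← Finset.mul_sum]
  simp only [real_inner_smul_left]
  ring

/-- One-sided tail bound for the spherical smoothing estimator in a fixed direction. -/
lemma measureReal_inner_ssGrad_ge_le {Ω : Type*} [MeasurableSpace Ω] {P : Measure Ω}
    [IsProbabilityMeasure P] {N : ℕ} (hN : 0 < N) (hn : n ≠ 0) (hf : Differentiable ℝ f)
    (hLip : LipschitzWith L (gradient f)) (hconv : StrongConvexOn Set.univ 0 f)
    (hL : 0 < L) (hD : 0 < D) (hw : ‖w‖ = 1) {u : Fin N → Ω → EuclideanSpace ℝ (Fin n)}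
    (hlaw : ∀ i, HasLaw (u i) (uniformSphere n) P) (hindep : iIndepFun u P) {t : ℝ} (ht : 0 ≤ t) :
    P.real {ω | inner ℝ (gradient f x) w + √n * L * D / 4 + t ≤
        inner ℝ (ssGrad f x D (fun i => u i ω)) w} ≤
      Real.exp (-(N * t ^ 2 / (2 * (n * (‖gradient f x‖ + L * D / 2) ^ 2 +
        n * (‖gradient f x‖ + L * D / 2) * t / 3)))) := by
  set q : EuclideanSpace ℝ (Fin n) → ℝ :=
    fun v => n * ((f (x + D • v) - f x) / D * inner ℝ v w) with hq
  have hqc : Continuous q := continuous_sub_div_mul_inner hf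
  have hL' : (0 : ℝ) < L := hL
  have h := measureReal_sum_ge_le_of_abs_le (P := P) (X := fun i => q ∘ u i)
    (hindep.comp (fun _ => q) fun _ => hqc.measurable)
    (fun i => hqc.measurable.comp_aemeasurable (hlaw i).aemeasurable)
    (R := n * (‖gradient f x‖ + L * D / 2)) (m := inner ℝ (gradient f x) w + √n * L * D / 4)
    (V := n * (‖gradient f x‖ + L * D / 2) ^ 2) (t := t) ?_ ?_ ?_ (by positivity) (by positivity) ht
  · rw [Fintype.card_fin] at h
    simp only [inner_ssGrad, le_div_iff₀ (Nat.cast_pos.2 hN : (0 : ℝ) < N)]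
    simp only [mul_comm _ (N : ℝ)]
    exact h
  · intro i
    have h1 : ∀ᵐ ω ∂P, ‖u i ω‖ = 1 := by
      have h2 := ae_norm_eq_one_uniformSphere (n := n)
      rw [← (hlaw i).map_eq] at h2
      exact ae_of_ae_map (hlaw i).aemeasurable h2
    filter_upwards [h1] with ω hω
    exact abs_mul_sub_div_mul_inner_le hf hLip hconv hD hw hω
  · intro i
    rw [(hlaw i).integral_comp hqc.aestronglyMeasurable]
    exact integral_mul_sub_div_mul_inner_le hn hf hLip hconv hD hw
  · intro i
    have : (q ∘ u i) ^ 2 = (q ^ 2) ∘ u i := rfl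
    rw [this, (hlaw i).integral_comp (hqc.pow 2).aestronglyMeasurable]
    exact integral_mul_sub_div_mul_inner_sq_le hn hf hLip hconv hD hw

lemma measureReal_inner_ssGrad_ge_le_half {Ω : Type*} [MeasurableSpace Ω] {P : Measure Ω}
    [IsProbabilityMeasure P] {N : ℕ} (hn : 1 ≤ n) (hf : Differentiable ℝ f)
    (hLip : LipschitzWith L (gradient f)) (hL : 0 < L) {μ θ lam ν m : ℝ} (hμ : 0 < μ)
    (hconv : StrongConvexOn Set.univ μ f)
    (hθ : θ ∈ Set.Ioo (0 : ℝ) (1 / 2)) (hlam : lam ∈ Set.Ioo (0 : ℝ) 1)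
    (hν : ν ∈ Set.Ioo (0 : ℝ) 1) (hm : 0 < m) (hD : D = θ * μ / (√n * L) * m)
    (hN : ssSampleSize n μ θ lam ν (‖gradient f x‖ / m) ≤ N) (hw : ‖w‖ = 1)
    {u : Fin N → Ω → EuclideanSpace ℝ (Fin n)}
    (hlaw : ∀ i, HasLaw (u i) (uniformSphere n) P) (hindep : iIndepFun u P) :
    P.real {ω | inner ℝ (gradient f x) w + μ * m / 2 ≤
        inner ℝ (ssGrad f x D (fun i => u i ω)) w} ≤ ν / 2 := by
  have hn0 : n ≠ 0 := by omega
  have hn' : (1 : ℝ) ≤ n := by exact_mod_cast hn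
  have hs0 : 0 < √(n : ℝ) := Real.sqrt_pos.2 (by positivity)
  have hL' : (0 : ℝ) < L := hL
  have hθ0 := hθ.1
  have hν0 := hν.1
  have hD0 : 0 < D := by rw [hD]; positivity
  set ρ := ‖gradient f x‖ / m / μ + θ / (2 * √n) with hρ
  set τ := 1 / 2 - θ / 4 with hτ
  have hρ0 : 0 < ρ := by positivity
  have hτ0 : 0 < τ := by rw [hτ]; linarith [hθ.2]
  set K := 2 * (n * ρ ^ 2 + n * ρ * τ / 3) with hK
  have hK0 : 0 < K := by positivity
  have hlog : 0 < Real.log ((n + 1) / ν) :=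
    Real.log_pos ((one_lt_div hν0).2 (by linarith [hν.2]))
  have hsize : K * Real.log ((n + 1) / ν) ≤ N * τ ^ 2 :=
    (two_mul_add_mul_log_le_ssSampleSize hn hμ hθ hlam hν (by positivity)).trans (by gcongr)
  have hN0 : 0 < N := by
    have h1 : 0 < N * τ ^ 2 := (mul_pos hK0 hlog).trans_le hsize
    have h2 : (0 : ℝ) < N := pos_of_mul_pos_left h1 (by positivity)
    exact_mod_cast h2
  have hLD : L * D = θ * μ * m / √n := by rw [hD]; field_simp
  have hB : ‖gradient f x‖ + L * D / 2 = μ * m * ρ := by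
    rw [hLD, hρ]; field_simp
  have hbias : √n * L * D / 4 + μ * m * τ = μ * m / 2 := by
    rw [mul_assoc, hLD, hτ]; field_simp; ring
  have h := measureReal_inner_ssGrad_ge_le (x := x) hN0 hn0 hf hLip (hconv.mono hμ.le) hL hD0 hw
    hlaw hindep (t := μ * m * τ) (by positivity)
  rw [add_assoc, hbias, hB] at h
  refine h.trans ?_
  have e : N * (μ * m * τ) ^ 2 / (2 * (n * (μ * m * ρ) ^ 2 + n * (μ * m * ρ) * (μ * m * τ) / 3)) =
      N * τ ^ 2 / K := by
    have : 2 * (n * (μ * m * ρ) ^ 2 + n * (μ * m * ρ) * (μ * m * τ) / 3) = (μ * m) ^ 2 * K := by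
      rw [hK]; ring
    rw [this]
    field_simp
  rw [e]
  calc _ ≤ Real.exp (-Real.log ((n + 1) / ν)) := by
        gcongr
        rwa [le_div_iff₀ hK0, mul_comm]
    _ = ν / (n + 1) := by
        rw [Real.exp_neg, Real.exp_log (by positivity), inv_div]
    -- Here `n + 1 ≥ 2`.
    _ ≤ ν / 2 := by gcongr; linarith

end Estimator

/-! ### Union bound over two consecutive estimators. -/

theorem theorem6p5 {n : ℕ} (hn : 1 ≤ n)
    (f : EuclideanSpace ℝ (Fin n) → ℝ) (Lf : ℝ≥0) (μ θ lam ν : ℝ)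
    (hf : Differentiable ℝ f) (hLip : LipschitzWith Lf (gradient f))
    (hμ : 0 < μ) (hconv : StrongConvexOn Set.univ μ f)
    (hθ : θ ∈ Set.Ioo (0 : ℝ) (1 / 2)) (hlam : lam ∈ Set.Ioo (0 : ℝ) 1)
    (hν : ν ∈ Set.Ioo (0 : ℝ) 1)
    (x : ℕ → EuclideanSpace ℝ (Fin n)) (hs : ∀ k, iterStep x k ≠ 0)
    (Δ : ℕ → ℝ) (N : ℕ → ℕ)
    (hΔ : ∀ k, Δ (k + 1) =
      θ * μ / (√n * Lf) * min ‖iterStep x k‖ ‖iterStep x (k + 1)‖)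
    (hN : ∀ k, ssSampleSize n μ θ lam ν
      (‖gradient f (x (k + 1))‖ / min ‖iterStep x k‖ ‖iterStep x (k + 1)‖) ≤ N (k + 1))
    {Ω : Type*} [MeasurableSpace Ω] (P : Measure Ω) [IsProbabilityMeasure P]
    (u : (k : ℕ) → Fin (N k) → Ω → EuclideanSpace ℝ (Fin n))
    (hlaw : ∀ k i, HasLaw (u k i) (uniformSphere n) P)
    (hindep : ∀ k, iIndepFun (u k) P) :
    ∀ k, 1 - ν ≤ P.real {ω | 0 < inner ℝ
      (ssGrad f (x (k + 2)) (Δ (k + 2)) (fun i => u (k + 2) i ω)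
        - ssGrad f (x (k + 1)) (Δ (k + 1)) (fun i => u (k + 1) i ω))
      (iterStep x (k + 1))} := by
  intro k
  have hm : ∀ j, 0 < min ‖iterStep x j‖ ‖iterStep x (j + 1)‖ := fun j =>
    lt_min (norm_pos_iff.2 (hs j)) (norm_pos_iff.2 (hs (j + 1)))
  set s := iterStep x (k + 1) with hsdef
  have hs0 : 0 < ‖s‖ := norm_pos_iff.2 (hs (k + 1))
  have hmono : μ * ‖s‖ ^ 2 ≤
      inner ℝ (gradient f (x (k + 2)) - gradient f (x (k + 1))) s :=
    hconv.mul_sq_le_inner_gradient_sub hf (x (k + 1)) (x (k + 2))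
  -- A zero Lipschitz constant would make the gradient constant, contradicting strong convexity
  -- along the nonzero step.
  have hL : 0 < Lf := by
    rw [pos_iff_ne_zero]
    rintro rfl
    have h := hLip.dist_le_mul (x (k + 2)) (x (k + 1))
    rw [NNReal.coe_zero, zero_mul, dist_eq_norm, norm_le_zero_iff] at h
    rw [h, inner_zero_left] at hmono
    have : 0 < μ * ‖s‖ ^ 2 := by positivity
    linarith
  set w := ‖s‖⁻¹ • s with hwdef
  have hw : ‖w‖ = 1 := by simpa using norm_smul_inv_norm (𝕜 := ℝ) (hs (k + 1))
  have hsw : s = ‖s‖ • w := by rw [hwdef, smul_inv_smul₀ hs0.ne']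
  have h1 := measureReal_inner_ssGrad_ge_le_half hn hf hLip hL hμ hconv hθ hlam hν (hm k) (hΔ k)
    (hN k) hw (hlaw (k + 1)) (hindep (k + 1))
  -- Overestimation along `w` is harmful at the earlier iterate, underestimation at the later one,
  -- hence the direction `-w`.
  have h2 := measureReal_inner_ssGrad_ge_le_half hn hf hLip hL hμ hconv hθ hlam hν (hm (k + 1))
    (hΔ (k + 1)) (hN (k + 1)) (w := -w) (by rw [norm_neg, hw]) (hlaw (k + 2)) (hindep (k + 2))
  set G := {ω | 0 < inner ℝ
      (ssGrad f (x (k + 2)) (Δ (k + 2)) (fun i => u (k + 2) i ω)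
        - ssGrad f (x (k + 1)) (Δ (k + 1)) (fun i => u (k + 1) i ω)) s}
  set A := {ω | inner ℝ (gradient f (x (k + 1))) w +
    μ * min ‖iterStep x k‖ ‖iterStep x (k + 1)‖ / 2 ≤
      inner ℝ (ssGrad f (x (k + 1)) (Δ (k + 1)) (fun i => u (k + 1) i ω)) w}
  set B := {ω | inner ℝ (gradient f (x (k + 2))) (-w) +
    μ * min ‖iterStep x (k + 1)‖ ‖iterStep x (k + 2)‖ / 2 ≤
      inner ℝ (ssGrad f (x (k + 2)) (Δ (k + 2)) (fun i => u (k + 2) i ω)) (-w)}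
  have hcover : Set.univ ⊆ G ∪ (A ∪ B) := by
    intro ω _
    by_contra hω
    simp only [Set.mem_union, not_or] at hω
    obtain ⟨hG, hA, hB⟩ := hω
    refine hG ?_
    simp only [A, B, Set.mem_ofPred_eq, not_le, inner_neg_right] at hA hB
    have m1 : μ * min ‖iterStep x k‖ ‖iterStep x (k + 1)‖ ≤ μ * ‖s‖ := by
      gcongr; exact min_le_right _ _
    have m2 : μ * min ‖iterStep x (k + 1)‖ ‖iterStep x (k + 2)‖ ≤ μ * ‖s‖ := by
      gcongr; exact min_le_left _ _
    have hmono' : μ * ‖s‖ ≤ inner ℝ (gradient f (x (k + 2)) - gradient f (x (k + 1))) w := by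
      rw [hwdef, real_inner_smul_right, le_inv_mul_iff₀ hs0]
      linarith
    rw [inner_sub_left] at hmono'
    change 0 < inner ℝ _ s
    rw [hsw, real_inner_smul_right, inner_sub_left]
    refine mul_pos hs0 ?_
    linarith
  -- Covering the whole space, rather than passing to the complement of `G`, requires no
  -- measurability of the events.
  have h3 : (1 : ℝ) ≤ P.real G + (P.real A + P.real B) := by
    rw [← probReal_univ (μ := P)]
    exact (measureReal_mono hcover).trans ((measureReal_union_le _ _).trans
      (add_le_add_right (measureReal_union_le _ _) _))
  linarith
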